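/- Work in first-order logic with equality and one binary predicate symbol $\in$; extensionality is not assumed. Let $T$ be the theory with the six axioms 1. Complements: $\forall A\,\exists x\,\forall y\,(y\in x\leftrightarrow y\notin A)$; 2. Pairing: $\forall a,b\,\exists x\,\forall y\,(y\in x\leftrightarrow y=a\vee y=b)$; 3. Set union: $\forall A\,\exists x\,\forall y\,(y\in x\leftrightarrow\exists m\,(m\in A\wedge y\in m))$; 4. Frege $1^*$: $\exists x\,\forall y\,(y\in x\leftrightarrow\exists z\,\forall m\,(m\in y\rightarrow m=z))$; 5. Preproduct: $\forall R,S\,\exists x\,\forall y\,\bigl(y\in x\leftrightarrow\exists r\in R\,\exists s\in S\,\forall z\in y\,(z\in s\vee z\in r)\bigr)$; 6. Unordered intersection relation set (not restricted to pairs): $\exists x\,\forall y\,(y\in x\leftrightarrow\exists z\,\forall m\,(m\in y\rightarrow z\in m))$. Write $\mathrm{pair}(x,a,b)$ for $\forall y\,(y\in x\leftrightarrow y=a\vee y=b)$. A formula is stratified if natural numbers (types) can be assigned to its variables, with distinct quantifiers binding distinct variables, none of which also occurs free, so that in each subformula $u=v$ both variables have the same type and in each subformula $u\in v$ the type of $v$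 is the type of $u$ plus one. Stratified comprehension $SF$ is the theory consisting of all sentences $\forall p_1\dots p_m\,\exists x\,\forall y\,(y\in x\leftrightarrow\varphi(p_1,\dots,p_m,y))$ where $\varphi$ is stratified and $x$ is not free in $\varphi$. Then: (a) $T$ logically implies (equivalently, by the completeness theorem, proves) the axiom of unordered composition $$\forall R,S\,\exists X\,\forall y\,\bigl(y\in X\leftrightarrow\exists a,b,c,r,s\,(\mathrm{pair}(y,a,c)\wedge r\in R\wedge s\in S\wedge\mathrm{pair}(r,a,b)\wedge\mathrm{pair}(s,b,c))\bigr).$$ (b) $T$ is a finite axiomatization of stratified comprehension: $T$ is finite, and a sentence is a logical consequence of $T$ if and only if it is a logical consequence of $SF$. -/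

import Mathlib

open FirstOrder FirstOrder.Language.Theory

namespace StratSet

/-- The only symbol of the language besides equality: the binary predicate `∈`. -/
inductive MemSymbol : ℕ → Type
  | mem : MemSymbol 2

/-- The first-order language of set theory, `FOL(=, ∈)`. -/
def L : FirstOrder.Language.{0, 0} := ⟨fun _ => Empty, MemSymbol⟩

/-! ### Formulas

Variables are numbered by the order in which they are quantified, starting from `0`. -/

/-- The formula `x ∈ y`. -/
def memF {α : Type} {n : ℕ} (x y : Fin n) : L.BoundedFormula α n :=
  FirstOrder.Language.Relations.boundedFormula₂ (L := L) MemSymbol.mem (&x) (&y)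

/-- The formula `x = y`. -/
def eqF {α : Type} {n : ℕ} (x y : Fin n) : L.BoundedFormula α n :=
  FirstOrder.Language.Term.bdEqual (L := L) (&x) (&y)

/-- The formula `pair(x, a, b)`, that is `∀ z (z ∈ x ↔ z = a ∨ z = b)`. -/
def pairF {α : Type} {n : ℕ} (x a b : Fin n) : L.BoundedFormula α n :=
  ∀' (memF (Fin.last n) x.castSucc ⇔
    (eqF (Fin.last n) a.castSucc ⊔ eqF (Fin.last n) b.castSucc))

/-! ### The axioms -/

/-- `∀ A ∃ x ∀ y (y ∈ x ↔ y ∉ A)`; variables `A, x, y`. -/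
def complementsAx : L.Sentence :=
  ∀' ∃' ∀' (memF (n := 3) 2 1 ⇔ ∼(memF 2 0))

/-- `∀ a, b ∃ x ∀ y (y ∈ x ↔ y = a ∨ y = b)`; variables `a, b, x, y`. -/
def pairingAx : L.Sentence :=
  ∀' ∀' ∃' ∀' (memF (n := 4) 3 2 ⇔ (eqF 3 0 ⊔ eqF 3 1))

/-- `∀ A ∃ x ∀ y (y ∈ x ↔ ∃ m ∈ A (y ∈ m))`; variables `A, x, y, m`. -/
def setUnionAx : L.Sentence :=
  ∀' ∃' ∀' (memF (n := 3) 2 1 ⇔ ∃' (memF (n := 4) 3 0 ⊓ memF 2 3))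

/-- `∃ x ∀ y (y ∈ x ↔ ∃ z ∀ m ∈ y (m = z))`; variables `x, y, z, m`. -/
def fregeOneStarAx : L.Sentence :=
  ∃' ∀' (memF (n := 2) 1 0 ⇔ ∃' ∀' (memF (n := 4) 3 1 ⟹ eqF 3 2))

/-- `∀ R, S ∃ x ∀ y (y ∈ x ↔ ∃ r ∈ R ∃ s ∈ S ∀ z ∈ y (z ∈ s ∨ z ∈ r))`;
variables `R, S, x, y, r, s, z`. -/
def preproductAx : L.Sentence :=
  ∀' ∀' ∃' ∀' (memF (n := 4) 3 2 ⇔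
    ∃' (memF (n := 5) 4 0 ⊓ ∃' (memF (n := 6) 5 1 ⊓
      ∀' (memF (n := 7) 6 3 ⟹ (memF 6 5 ⊔ memF 6 4)))))

/-- `∃ x ∀ y (y ∈ x ↔ ∃ z ∀ m ∈ y (z ∈ m))`; variables `x, y, z, m`. -/
def intersectionRelationAx : L.Sentence :=
  ∃' ∀' (memF (n := 2) 1 0 ⇔ ∃' ∀' (memF (n := 4) 3 1 ⟹ memF 2 3))

/-- The six-axiom system. -/
def sixAxioms : L.Theory :=
  {complementsAx, pairingAx, setUnionAx, fregeOneStarAx, preproductAx, intersectionRelationAx}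

/-- Unordered relative products (composition):
`∀ R, S ∃ X ∀ y (y ∈ X ↔ ∃ a, b, c, r, s
  (pair(y, a, c) ∧ r ∈ R ∧ s ∈ S ∧ pair(r, a, b) ∧ pair(s, b, c)))`;
variables `R, S, X, y, a, b, c, r, s`. -/
def compositionAx : L.Sentence :=
  ∀' ∀' ∃' ∀' (memF (n := 4) 3 2 ⇔
    ∃' ∃' ∃' ∃' ∃' (pairF (n := 9) 3 4 6 ⊓ memF 7 0 ⊓ memF 8 1 ⊓ pairF 7 4 5 ⊓ pairF 8 5 6))

/-! ### Stratified comprehension -/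

/-- The type of a term (necessarily a variable), given the types of the free and of the
quantified variables. -/
def termType {α : Type} {n : ℕ} (f : α → ℕ) (b : Fin n → ℕ) : L.Term (α ⊕ Fin n) → ℕ
  | .var v => Sum.elim f b v
  | .func g _ => Empty.elim g

/-- The typing `f` of the free variables and `b` of the quantified variables in scope extends to a
stratification of the formula: the quantifiers in it can be given types such that the two sides of
every `s = t` have the same type, and in every `s ∈ t` the type of `t` is the successor of the type
of `s`. -/
def StratifiedBy {α : Type} (f : α → ℕ) :
    {n : ℕ} → (Fin n → ℕ) → L.BoundedFormula α n → Prop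
  | _, _, .falsum => True
  | _, b, .equal s t => termType f b s = termType f b t
  | _, b, .rel MemSymbol.mem ts => termType f b (ts 1) = termType f b (ts 0) + 1
  | _, b, .imp φ ψ => StratifiedBy f b φ ∧ StratifiedBy f b ψ
  | _, b, .all φ => ∃ k : ℕ, StratifiedBy f (Fin.snoc b k) φ

/-- A formula is stratified if its variables can be given types that make it well-typed. -/
def Stratified {α : Type} (φ : L.Formula α) : Prop :=
  ∃ f : α → ℕ, StratifiedBy f Fin.elim0 φ

/-- For `φ(p₁, …, pₘ, y)`, whose free variables are the `m` parameters `Sum.inl i` and the variable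
`y = Sum.inr ()`, the sentence `∀ p₁ … pₘ ∃ x ∀ y (y ∈ x ↔ φ(p₁, …, pₘ, y))`. -/
def comprehension (m : ℕ) (φ : L.Formula (Fin m ⊕ Unit)) : L.Sentence :=
  FirstOrder.Language.BoundedFormula.alls (n := m) (∃' ∀' (memF (Fin.last (m + 1)) (Fin.last m).castSucc ⇔
    FirstOrder.Language.BoundedFormula.relabel (n := m + 2) (k := 0)
      (fun v => Sum.inr (Sum.elim (fun i => i.castSucc.castSucc) (fun _ => Fin.last (m + 1)) v))
      φ))

/-- Stratified comprehension `SF`: all comprehension sentences of stratified formulas. -/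
def SF : L.Theory :=
  {σ | ∃ (m : ℕ) (φ : L.Formula (Fin m ⊕ Unit)), Stratified φ ∧ σ = comprehension m φ}

end StratSet

/-! By semantics it is enough that a nonempty structure satisfies `sixAxioms` exactly when it
satisfies `SF`. One direction is immediate: the six axioms, and the composition axiom too, are
instances of stratified comprehension. So (a) also follows from the converse.

For the converse, a stratified relation on tuples is represented by a family of finite sets. An
entry `x` is replaced by a code `{...{{x}, t}..., t}`, whose tag `t` tells which variable the entry
belongs to; a tuple is the unordered set of the codes of its entries. Tags have at least three
elements, so they are never confused with codes. Without extensionality an entry has many codes, but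
a code still determines its tag and its entry.

A variable of type `τ` is coded at level `N - τ + 1`, with `N` bounding all types. Then equality
compares codes of equal level, and membership compares a code with one that is one level lower
(`codedRel_eq_level`, `codedRel_mem_level`). Both start from the intersection relation and are
lifted level by level through `linked`, a composition of relations between disjoint sets. Induction
on formulas (`SixClosed.tuples_formula`) uses Boolean operations for connectives and passage to
subsets for quantifiers; fixing the parameters and decoding (`of_tuples`) yields the comprehension
set. -/

namespace StratSet

/-! ### Closure of extensions under set operations and composition -/

section Closure

variable {M : Type*} {E : M → M → Prop}

/-- The extension of `x`: the set of its `E`-elements. -/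
def ext (E : M → M → Prop) (x : M) : Set M := {y | E y x}

/-- The extension of some element of the structure. -/
def IsSet (E : M → M → Prop) (A : Set M) : Prop := ∃ x, ext E x = A

/-- The six axioms, as closure properties of the family of extensions. -/
structure SixClosed (E : M → M → Prop) : Prop where
  compl : ∀ {A}, IsSet E A → IsSet E Aᶜ
  pair : ∀ a b, IsSet E {a, b}
  sUnion : ∀ {A}, IsSet E A → IsSet E {y | ∃ m ∈ A, y ∈ ext E m}
  subsing : IsSet E {y | ∃ z, ext E y ⊆ {z}}
  pre : ∀ {R S}, IsSet E R → IsSet E S →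
    IsSet E {y | ∃ r ∈ R, ∃ s ∈ S, ext E y ⊆ ext E s ∪ ext E r}
  inter : IsSet E {y | ∃ z, ∀ m ∈ ext E y, z ∈ ext E m}

theorem IsSet.congr {A B : Set M} (h : IsSet E A) (hAB : ∀ y, y ∈ B ↔ y ∈ A) : IsSet E B := by
  rwa [Set.ext hAB]

namespace SixClosed

variable (h : SixClosed E)
include h

theorem union {A B : Set M} (hA : IsSet E A) (hB : IsSet E B) : IsSet E (A ∪ B) := by
  obtain ⟨a, rfl⟩ := hA
  obtain ⟨b, rfl⟩ := hB
  exact (h.sUnion (h.pair a b)).congr fun y => by simp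

theorem inter₂ {A B : Set M} (hA : IsSet E A) (hB : IsSet E B) : IsSet E (A ∩ B) := by
  have := h.compl (h.union (h.compl hA) (h.compl hB))
  simpa [Set.compl_union] using this

theorem sdiff {A B : Set M} (hA : IsSet E A) (hB : IsSet E B) : IsSet E (A \ B) :=
  h.inter₂ hA (h.compl hB)

theorem singleton (a : M) : IsSet E {a} := (h.pair a a).congr fun y => by simp

theorem univ [Nonempty M] : IsSet E (Set.univ : Set M) := by
  have hA := h.singleton (Classical.arbitrary M)
  exact (h.union hA (h.compl hA)).congr fun y => by simp

theorem empty [Nonempty M] : IsSet E (∅ : Set M) := by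
  simpa using h.compl h.univ

theorem biUnion [Nonempty M] {ι : Type*} (s : Finset ι) (D : ι → Set M)
    (hD : ∀ i, IsSet E (D i)) : IsSet E {y | ∃ i ∈ s, y ∈ D i} := by
  classical
  induction s using Finset.induction_on with
  | empty => exact h.empty.congr fun y => by simp
  | insert a s _ ih => exact (h.union (hD a) ih).congr fun y => by simp

theorem biInter [Nonempty M] {ι : Type*} (s : Finset ι) (D : ι → Set M)
    (hD : ∀ i, IsSet E (D i)) : IsSet E {y | ∀ i ∈ s, y ∈ D i} := by
  classical
  induction s using Finset.induction_on with
  | empty => exact h.univ.congr fun y => by simp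
  | insert a s _ ih => exact (h.inter₂ (hD a) ih).congr fun y => by simp

theorem of_finite [Nonempty M] {A : Set M} (hA : A.Finite) : IsSet E A :=
  (h.biUnion hA.toFinset (fun a => {a}) h.singleton).congr fun y => by simp

/-- Sets below a member of `R`, up to elements of `A`. -/
theorem below {R A : Set M} (hR : IsSet E R) (hA : IsSet E A) :
    IsSet E {y | ∃ r ∈ R, ext E y ⊆ ext E r ∪ A} := by
  obtain ⟨a, rfl⟩ := hA
  exact (h.pre (h.singleton a) hR).congr fun y => by simp

theorem powerset [Nonempty M] {A : Set M} (hA : IsSet E A) : IsSet E {y | ext E y ⊆ A} := by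
  obtain ⟨a, rfl⟩ := hA
  exact (h.below (h.singleton a) h.empty).congr fun y => by simp

theorem meets [Nonempty M] {A : Set M} (hA : IsSet E A) :
    IsSet E {y | ∃ a ∈ A, a ∈ ext E y} := by
  refine (h.compl (h.powerset (h.compl hA))).congr fun y => ?_
  simp [Set.subset_def, and_comm]

theorem singletons [Nonempty M] {A : Set M} (hA : IsSet E A) :
    IsSet E {y | ∃ a ∈ A, ext E y = {a}} := by
  refine (h.inter₂ h.subsing (h.meets hA)).congr fun y => ?_
  constructor
  · rintro ⟨a, ha, hy⟩
    exact ⟨⟨a, hy.le⟩, a, ha, by simp [hy]⟩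
  · rintro ⟨⟨z, hz⟩, a, ha, hay⟩
    obtain rfl : a = z := hz hay
    exact ⟨a, ha, hz.antisymm (by simpa using hay)⟩

/-- Preproduct of singletons gives the sets inside some `{a, b}`. Meeting both `A` and `B` excludes
the proper subsets, except a singleton in `A ∩ B`, which is itself of the form `{a, a}`. -/
theorem unordered_prod [Nonempty M] {A B : Set M} (hA : IsSet E A) (hB : IsSet E B) :
    IsSet E {y | ∃ a ∈ A, ∃ b ∈ B, ext E y = {a, b}} := by
  refine (h.inter₂ (h.pre (h.singletons hA) (h.singletons hB))
    (h.inter₂ (h.meets hA) (h.meets hB))).congr fun y => ?_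
  constructor
  · rintro ⟨a, ha, b, hb, hy⟩
    obtain ⟨r, hr⟩ := h.singleton a
    obtain ⟨s, hs⟩ := h.singleton b
    refine ⟨⟨r, ⟨a, ha, hr⟩, s, ⟨b, hb, hs⟩, ?_⟩, ⟨a, ha, ?_⟩, b, hb, ?_⟩ <;>
      simp [*]
  · rintro ⟨⟨r, ⟨a, ha, hr⟩, s, ⟨b, hb, hs⟩, hy⟩, ⟨a', ha', hay⟩, b', hb', hby⟩
    rw [hr, hs] at hy
    by_cases h1 : a ∈ ext E y <;> by_cases h2 : b ∈ ext E y
    · exact ⟨a, ha, b, hb, by grind⟩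
    · exact ⟨a, ha, a, by grind, by grind⟩
    · exact ⟨b, by grind, b, hb, by grind⟩
    · grind

/-- Composition of relations between pairwise disjoint sets. -/
theorem comp [Nonempty M] {A B C : Set M} {R S : M → M → Prop}
    (hA : IsSet E A) (hB : IsSet E B) (hC : IsSet E C)
    (hAB : Disjoint A B) (hBC : Disjoint B C) (hAC : Disjoint A C)
    (hR : IsSet E {y | ∃ a ∈ A, ∃ b ∈ B, R a b ∧ ext E y = {a, b}})
    (hS : IsSet E {y | ∃ b ∈ B, ∃ c ∈ C, S b c ∧ ext E y = {b, c}}) :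
    IsSet E {y | ∃ a ∈ A, ∃ c ∈ C, (∃ b ∈ B, R a b ∧ S b c) ∧ ext E y = {a, c}} := by
  -- A member `t` satisfies `t ⊆ {a, b} ∪ C` and `t ⊆ {b', c} ∪ A`. By disjointness its only
  -- possible elements in `A` and `C` are `a` and `c`, and meeting `B` forces `b = b'`. The
  -- composition consists of the pairs of `A` and `C` below such a `t`.
  have hT := h.inter₂ (h.inter₂ (h.below hR hC) (h.below hS hA)) (h.meets hB)
  refine (h.inter₂ (h.below hT h.empty) (h.unordered_prod hA hC)).congr fun y => ?_
  rw [Set.disjoint_left] at hAB hBC hAC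
  constructor
  · rintro ⟨a, ha, c, hc, ⟨b, hb, hab, hbc⟩, hy⟩
    obtain ⟨t, ht⟩ := h.of_finite (A := {a, b, c}) (by simp)
    obtain ⟨r, hr⟩ := h.pair a b
    obtain ⟨s, hs⟩ := h.pair b c
    refine ⟨⟨t, ⟨⟨⟨r, ⟨a, ha, b, hb, hab, hr⟩, ?_⟩, ⟨s, ⟨b, hb, c, hc, hbc, hs⟩, ?_⟩⟩,
      ⟨b, hb, ?_⟩⟩, ?_⟩, a, ha, c, hc, hy⟩
    all_goals grind
  · rintro ⟨⟨t, ⟨⟨⟨r, ⟨a, ha, b, hb, hab, hr⟩, htr⟩, ⟨s, ⟨b', hb', c, hc, hbc, hs⟩, hts⟩⟩,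
      ⟨b₀, hb₀, hbt⟩⟩, hyt⟩, a₁, ha₁, c₁, hc₁, hy⟩
    clear hR hS hT hA hB hC
    have e1 : a₁ ∈ ext E t := by simpa using hyt (by simp [hy])
    have e2 : c₁ ∈ ext E t := by simpa using hyt (by simp [hy])
    rw [hr] at htr
    rw [hs] at hts
    clear hr hs hyt
    have f1 : a₁ = a := by grind
    have f2 : c₁ = c := by grind
    have f3 : b₀ = b := by grind
    have f4 : b₀ = b' := by grind
    exact ⟨a₁, ha₁, c₁, hc₁, ⟨b, hb, by grind, by grind⟩, hy⟩

/-- The intersection relation between two sets. -/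
theorem intersecting [Nonempty M] {A B : Set M} (hA : IsSet E A) (hB : IsSet E B) :
    IsSet E {y | ∃ a ∈ A, ∃ b ∈ B, (∃ z, z ∈ ext E a ∧ z ∈ ext E b) ∧ ext E y = {a, b}} := by
  refine (h.inter₂ (h.unordered_prod hA hB) h.inter).congr fun y => ?_
  constructor
  · rintro ⟨a, ha, b, hb, ⟨z, hz⟩, hy⟩
    exact ⟨⟨a, ha, b, hb, hy⟩, z, by rw [hy]; simpa using hz⟩
  · rintro ⟨⟨a, ha, b, hb, hy⟩, z, hz⟩
    exact ⟨a, ha, b, hb, ⟨z, by rw [hy] at hz; simpa using hz⟩, hy⟩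

/-- Two elements of disjoint sets `A` and `C` that both meet a member of `B`. -/
theorem linked [Nonempty M] {A B C : Set M}
    (hA : IsSet E A) (hB : IsSet E B) (hC : IsSet E C)
    (hAB : Disjoint A B) (hBC : Disjoint B C) (hAC : Disjoint A C) :
    IsSet E {y | ∃ a ∈ A, ∃ c ∈ C, (∃ b ∈ B, (∃ z, z ∈ ext E a ∧ z ∈ ext E b) ∧
      ∃ z, z ∈ ext E b ∧ z ∈ ext E c) ∧ ext E y = {a, c}} :=
  h.comp hA hB hC hAB hBC hAC (h.intersecting hA hB) (h.intersecting hB hC)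

end SixClosed
end Closure

/-! ### Tagged codes, and equality and membership between them -/

section Codes

variable {M : Type*} {E : M → M → Prop}

/-- `Code E t n e x`: `e` arises from a singleton `{x}` by `n`-fold pairing with the tag `t`. -/
def Code (E : M → M → Prop) (t : M) : ℕ → M → M → Prop
  | 0, e, x => ext E e = {x}
  | n + 1, e, x => ∃ u, Code E t n u x ∧ ext E e = {u, t}

/-- Tags have at least three elements. -/
def IsTag (E : M → M → Prop) (t : M) : Prop := ∀ a b, ¬ ext E t = {a, b}

theorem Code.small {t e x : M} {n : ℕ} (hc : Code E t n e x) : ∃ a b, ext E e = {a, b} := by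
  cases n with
  | zero => exact ⟨x, x, by simpa [Code] using hc⟩
  | succ n =>
    obtain ⟨u, _, hu⟩ := hc
    exact ⟨u, t, hu⟩

theorem Code.ne_tag {t e x t' : M} {n : ℕ} (hc : Code E t n e x) (ht : IsTag E t') : e ≠ t' := by
  rintro rfl
  obtain ⟨a, b, hab⟩ := hc.small
  exact ht a b hab

/-- The tag is not a code, so `u` can be recovered from `{u, t}` at each level. -/
theorem Code.unique {t e x x' : M} {n : ℕ} (ht : IsTag E t) (hc : Code E t n e x)
    (hc' : Code E t n e x') : x = x' := by
  induction n generalizing e with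
  | zero => simpa [Code] using hc.symm.trans hc'
  | succ n ih =>
    obtain ⟨u, hu, he⟩ := hc
    obtain ⟨u', hu', he'⟩ := hc'
    have hue : u ∈ ext E e := by simp [he]
    rw [he'] at hue
    obtain rfl : u = u' := hue.resolve_right (hu.ne_tag ht)
    exact ih hu hu'

theorem Code.tag_unique {t t' e x x' : M} {n n' : ℕ} (ht : IsTag E t)
    (hc : Code E t (n + 1) e x) (hc' : Code E t' (n' + 1) e x') : t = t' := by
  obtain ⟨u, hu, he⟩ := hc
  obtain ⟨u', hu', he'⟩ := hc'
  have := hu'.ne_tag ht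
  grind

theorem Code.not_zero {t t' e x x' : M} {n : ℕ} (ht : IsTag E t)
    (hc : Code E t (n + 1) e x) (hc' : Code E t' 0 e x') : False := by
  obtain ⟨u, hu, he⟩ := hc
  have := hu.ne_tag ht
  simp only [Code] at hc'
  have h1 : u ∈ ({x'} : Set M) := by rw [← hc', he]; simp
  have h2 : t ∈ ({x'} : Set M) := by rw [← hc', he]; simp
  grind

/-- The binary relation `φ`, transported to codes with tags `t`, `t'` of levels `n`, `n'`. -/
def codedRel (E : M → M → Prop) (t : M) (n : ℕ) (t' : M) (n' : ℕ) (φ : M → M → Prop) : Set M :=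
  {y | ∃ a ∈ {e | ∃ x, Code E t n e x}, ∃ b ∈ {e | ∃ x, Code E t' n' e x},
    (∃ x x', Code E t n a x ∧ Code E t' n' b x' ∧ φ x x') ∧ ext E y = {a, b}}

namespace SixClosed

variable (h : SixClosed E)
include h

theorem exists_code (t : M) (n : ℕ) (x : M) : ∃ e, Code E t n e x := by
  induction n with
  | zero => exact h.singleton x
  | succ n ih =>
    obtain ⟨u, hu⟩ := ih
    obtain ⟨e, he⟩ := h.pair u t
    exact ⟨e, u, hu, he⟩

theorem codes [Nonempty M] (t : M) (n : ℕ) {A : Set M} (hA : IsSet E A) :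
    IsSet E {e | ∃ x ∈ A, Code E t n e x} := by
  induction n with
  | zero => exact h.singletons hA
  | succ n ih =>
    refine (h.unordered_prod ih (h.singleton t)).congr fun y => ?_
    simp only [Code, Set.mem_ofPred_eq, Set.mem_singleton_iff, exists_eq_left]
    grind

theorem all_codes [Nonempty M] (t : M) (n : ℕ) : IsSet E {e | ∃ x, Code E t n e x} :=
  (h.codes t n h.univ).congr fun y => by simp

/-- Set union undoes one level of coding, up to the tag, which is then removed. -/
theorem of_codes [Nonempty M] {t : M} (ht : IsTag E t) {n : ℕ} {A : Set M}
    (hA : IsSet E {e | ∃ x ∈ A, Code E t n e x}) : IsSet E A := by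
  induction n with
  | zero =>
    refine (h.sUnion hA).congr fun y => ?_
    constructor
    · intro hy
      obtain ⟨e, he⟩ := h.singleton y
      exact ⟨e, ⟨y, hy, he⟩, by simp [he]⟩
    · rintro ⟨m, ⟨x, hx, hm⟩, hy⟩
      simp only [Code] at hm
      rw [hm] at hy
      obtain rfl : y = x := hy
      exact hx
  | succ n ih =>
    refine ih ((h.sdiff (h.sUnion hA) (h.singleton t)).congr fun u => ?_)
    constructor
    · rintro ⟨x, hx, hu⟩
      obtain ⟨e, he⟩ := h.pair u t
      exact ⟨⟨e, ⟨x, hx, u, hu, he⟩, by simp [he]⟩, hu.ne_tag ht⟩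
    · rintro ⟨⟨m, ⟨x, hx, u', hu', hm⟩, hu⟩, hut⟩
      rw [hm] at hu
      obtain rfl : u = u' := by simpa [show u ≠ t from hut] using hu
      exact ⟨x, hx, hu'⟩

/-- Codes `{u, t}` and `{u', t'}` of level 1 are linked by `q = {u, u'}`, where `u` and `u'` are
singletons with a common element. The intersection axiom is needed because `u` and `u'` may differ
although both have extension `{x}`. -/
theorem codedRel_eq [Nonempty M] {t t' : M} (ht : IsTag E t) (ht' : IsTag E t') (hne : t ≠ t') :
    IsSet E (codedRel E t 1 t' 1 Eq) := by
  have hQ := h.inter₂ (h.powerset (h.all_codes t 0)) h.inter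
  have hnt : ∀ t, IsTag E t → ∀ q, ext E q ⊆ {e | ∃ x, Code E t 0 e x} → t ∉ ext E q := by
    intro t ht q hq htq
    obtain ⟨x, hx⟩ := hq htq
    exact hx.ne_tag ht rfl
  have key : ∀ t, IsTag E t → Disjoint {e | ∃ x, Code E t 1 e x}
      ({y | ext E y ⊆ {e | ∃ x, Code E t 0 e x}} ∩ {y | ∃ z, ∀ m ∈ ext E y, z ∈ ext E m}) := by
    intro t ht
    rw [Set.disjoint_left]
    rintro e ⟨x, u, hu, he⟩ ⟨hq, _⟩
    exact hnt t ht e hq (by simp [he])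
  refine (h.linked (h.all_codes t 1) hQ (h.all_codes t' 1) (key t ht) (key t' ht').symm
    (by
      rw [Set.disjoint_left]
      rintro e ⟨x, hx⟩ ⟨x', hx'⟩
      exact hne (hx.tag_unique ht hx'))).congr fun y => ?_
  constructor
  · rintro ⟨a, ha, b, hb, ⟨x, _, ⟨u, hu, hau⟩, ⟨u', hu', hbu'⟩, rfl⟩, hy⟩
    obtain ⟨q, hq⟩ := h.pair u u'
    simp only [Code] at hu hu'
    refine ⟨a, ha, b, hb, ⟨q, ⟨?_, x, ?_⟩, ⟨u, ?_⟩, ⟨u', ?_⟩⟩, hy⟩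
    · rw [Set.mem_ofPred_eq, hq, Set.insert_subset_iff, Set.singleton_subset_iff]
      exact ⟨⟨x, hu⟩, ⟨x, hu'⟩⟩
    · simp [hq, hu, hu']
    · simp [hau, hq]
    · simp [hbu', hq]
  · rintro ⟨a, ha, b, hb, ⟨q, ⟨hq, z, hz⟩, ⟨u, hua, huq⟩, ⟨u', hu'q, hu'b⟩⟩, hy⟩
    refine ⟨a, ha, b, hb, ?_, hy⟩
    obtain ⟨x, v, hv, hav⟩ := ha
    obtain ⟨x', v', hv', hbv'⟩ := hb
    obtain rfl : u = v := by
      have : u ≠ t := fun e => hnt t ht q hq (e ▸ huq)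
      simpa [hav, this] using hua
    obtain rfl : u' = v' := by
      have : u' ≠ t' := fun e => hnt t' ht' q hq (e ▸ hu'q)
      simpa [hbv', this] using hu'b
    have e1 := hz u huq
    have e2 := hz u' hu'q
    simp only [Code] at hv hv'
    rw [hv] at e1
    rw [hv'] at e2
    exact ⟨x, x', ⟨u, hv, hav⟩, ⟨u', hv', hbv'⟩, e1.symm.trans e2⟩

/-- With `s = {x}`, the codes `{s, t}` and `{y}` are linked by `q = {s, y}`, whose two elements have
a common element iff `x ∈ y`. To keep the three sets disjoint, `q` must be neither a singleton nor
contain `t`, so the cases `y = s` and `y = t` are added separately, as `hmeet` and `htag`. -/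
theorem codedRel_mem [Nonempty M] {t t' : M} (ht : IsTag E t) :
    IsSet E (codedRel E t 1 t' 0 E) := by
  have h1 := h.all_codes t 0
  have hW := h.inter₂ (h.inter₂ (h.unordered_prod h1 h.univ) h.inter)
    (h.compl (h.union h1 (h.meets (h.singleton t))))
  have hA := h.all_codes t 1
  have hst : IsSet E {v | ext E v = {t}} :=
    (h.singletons (h.singleton t)).congr fun y => by simp
  have hlink := h.linked hA hW h1
    (by
      rw [Set.disjoint_left]
      rintro e ⟨x, u, hu, he⟩ ⟨_, hn⟩
      exact hn (Or.inr ⟨t, rfl, by simp [he]⟩))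
    (by
      rw [Set.disjoint_left]
      rintro e ⟨_, hn⟩ hs
      exact hn (Or.inl hs))
    (by
      rw [Set.disjoint_left]
      rintro e ⟨x, hx⟩ ⟨x', hx'⟩
      exact hx.not_zero ht hx')
  have hmeet := h.intersecting hA (h.sdiff h1 hst)
  have htag := h.unordered_prod (h.codes t 1 ⟨t, rfl⟩) hst
  refine (h.union hlink (h.union hmeet htag)).congr fun w => ?_
  constructor
  · rintro ⟨e, he, v, ⟨_, _⟩, ⟨x, y, hx, hv, hxy⟩, hw⟩
    obtain ⟨s, hs, hes⟩ := id hx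
    simp only [Code] at hv hs
    by_cases hyt : y = t
    · subst hyt
      exact Or.inr (Or.inr ⟨e, ⟨x, hxy, hx⟩, v, hv, hw⟩)
    have htv : ¬ ext E v = {t} := by
      rw [hv]
      simpa using hyt
    by_cases hys : y = s
    · subst hys
      exact Or.inr (Or.inl ⟨e, he, v, ⟨⟨y, hv⟩, htv⟩, ⟨y, by simp [hes], by simp [hv]⟩, hw⟩)
    obtain ⟨q, hq⟩ := h.pair s y
    refine Or.inl ⟨e, he, v, ⟨y, hv⟩, ⟨q, ⟨⟨⟨s, ⟨x, hs⟩, y, trivial, hq⟩, x, ?_⟩, ?_⟩,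
      ⟨s, by simp [hes], by simp [hq]⟩, ⟨y, by simp [hq], by simp [hv]⟩⟩, hw⟩
    · intro m hm
      rw [hq] at hm
      rcases hm with rfl | rfl
      · simp [hs]
      · exact hxy
    · rintro (⟨z, hz⟩ | ⟨_, rfl, htq⟩)
      · simp only [Code] at hz
        have e1 : s ∈ ({z} : Set M) := by rw [← hz, hq]; simp
        have e2 : y ∈ ({z} : Set M) := by rw [← hz, hq]; simp
        exact hys (e2.trans e1.symm)
      · rw [hq] at htq
        rcases htq with rfl | rfl
        · exact ht x x (by simpa using hs)
        · exact hyt rfl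
  · rintro (⟨e, he, v, hv, ⟨q, ⟨⟨⟨s₀, ⟨x₀, hs₀⟩, y₀, -, hq⟩, z, hz⟩, hn⟩, ⟨s, hse, hsq⟩,
        ⟨y, hyq, hyv⟩⟩, hw⟩ | ⟨e, he, v, ⟨hv, hvt⟩, ⟨s, hse, hsv⟩, hw⟩ |
        ⟨e, ⟨x, hxt, hx⟩, v, hv, hw⟩)
    · refine ⟨e, he, v, hv, ?_, hw⟩
      obtain ⟨x, s', hs', hes'⟩ := he
      obtain ⟨y', hy'⟩ := id hv
      simp only [Code] at hy' hs' hs₀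
      obtain rfl : y = y' := by simpa [hy'] using hyv
      obtain rfl : s = s' := by
        have : s ≠ t := by
          rintro rfl
          exact hn (Or.inr ⟨_, rfl, hsq⟩)
        simpa [hes', this] using hse
      refine ⟨x, y, ⟨s, hs', hes'⟩, hy', ?_⟩
      have e1 := hz s hsq
      rw [hs'] at e1
      obtain rfl : z = x := e1
      exact hz y hyq
    · refine ⟨e, he, v, hv, ?_, hw⟩
      obtain ⟨x, s', hs', hes'⟩ := he
      obtain ⟨y', hy'⟩ := id hv
      simp only [Code] at hy' hs'
      obtain rfl : s = y' := by simpa [hy'] using hsv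
      obtain rfl : s = s' := by
        have : s ≠ t := by
          rintro rfl
          exact hvt hy'
        simpa [hes', this] using hse
      refine ⟨x, s, ⟨s, hs', hes'⟩, hy', ?_⟩
      have : x ∈ ext E s := by simp [hs']
      exact this
    · exact ⟨e, ⟨x, hx⟩, v, ⟨t, hv⟩, ⟨x, t, hx, hv, hxt⟩, hw⟩

/-- A pair `q = {u, u'}` of the given relation contains no tag, so it meets `{u, t}` and `{u', t'}`
only in `u` and `u'`: linking through the relation raises both levels by one. -/
theorem codedRel_succ [Nonempty M] {t t' : M} (ht : IsTag E t) (ht' : IsTag E t') (hne : t ≠ t')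
    {n n' : ℕ} {φ : M → M → Prop} (hR : IsSet E (codedRel E t (n + 1) t' n' φ)) :
    IsSet E (codedRel E t (n + 2) t' (n' + 1) φ) := by
  have hdis : ∀ a b x x', Code E t (n + 1) a x → Code E t' n' b x' → a ≠ b := by
    rintro a _ x x' ha hb rfl
    cases n' with
    | zero => exact ha.not_zero ht hb
    | succ n' => exact hne (ha.tag_unique ht hb)
  have hnt : ∀ s, IsTag E s → ∀ q ∈ codedRel E t (n + 1) t' n' φ, s ∉ ext E q := by
    rintro s hs q ⟨a, ⟨x, hx⟩, b, ⟨x', hx'⟩, -, hq⟩ hsq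
    rw [hq] at hsq
    rcases hsq with rfl | rfl
    · exact hx.ne_tag hs rfl
    · exact hx'.ne_tag hs rfl
  refine (h.linked (h.all_codes t (n + 2)) hR (h.all_codes t' (n' + 1)) ?_ ?_ ?_).congr
    fun y => ?_
  · rw [Set.disjoint_left]
    rintro e ⟨x, u, hu, he⟩ hq
    exact hnt t ht e hq (by simp [he])
  · rw [Set.disjoint_right]
    rintro e ⟨x, u, hu, he⟩ hq
    exact hnt t' ht' e hq (by simp [he])
  · rw [Set.disjoint_left]
    rintro e ⟨x, hx⟩ ⟨x', hx'⟩
    exact hne (hx.tag_unique ht hx')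
  constructor
  · rintro ⟨a, ha, b, hb, ⟨x, x', ⟨u, hu, hau⟩, ⟨u', hu', hbu'⟩, hφ⟩, hy⟩
    obtain ⟨q, hq⟩ := h.pair u u'
    exact ⟨a, ha, b, hb, ⟨q, ⟨u, ⟨x, hu⟩, u', ⟨x', hu'⟩, ⟨x, x', hu, hu', hφ⟩, hq⟩,
      ⟨u, by simp [hau], by simp [hq]⟩, ⟨u', by simp [hq], by simp [hbu']⟩⟩, hy⟩
  · rintro ⟨a, ha, b, hb, ⟨q, hqR, ⟨u, hua, huq⟩, ⟨u', hu'q, hu'b⟩⟩, hy⟩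
    refine ⟨a, ha, b, hb, ?_, hy⟩
    obtain ⟨x, v, hv, hav⟩ := ha
    obtain ⟨x', v', hv', hbv'⟩ := hb
    obtain rfl : u = v := by
      have : u ≠ t := fun e => hnt t ht q hqR (e ▸ huq)
      simpa [hav, this] using hua
    obtain rfl : u' = v' := by
      have : u' ≠ t' := fun e => hnt t' ht' q hqR (e ▸ hu'q)
      simpa [hbv', this] using hu'b
    obtain ⟨a₀, -, b₀, -, ⟨x₀, x₀', hx₀, hx₀', hφ⟩, hq⟩ := hqR
    rw [hq] at huq hu'q
    obtain rfl : u = a₀ := huq.resolve_right (hdis _ _ _ _ hv hx₀')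
    obtain rfl : u' = b₀ := hu'q.resolve_left (hdis _ _ _ _ hx₀ hv').symm
    exact ⟨x₀, x₀', ⟨u, hx₀, hav⟩, ⟨u', hx₀', hbv'⟩, hφ⟩

theorem codedRel_eq_level [Nonempty M] {t t' : M} (ht : IsTag E t) (ht' : IsTag E t')
    (hne : t ≠ t') (n : ℕ) : IsSet E (codedRel E t (n + 1) t' (n + 1) Eq) := by
  induction n with
  | zero => exact h.codedRel_eq ht ht' hne
  | succ n ih => exact h.codedRel_succ ht ht' hne ih

theorem codedRel_mem_level [Nonempty M] {t t' : M} (ht : IsTag E t) (ht' : IsTag E t')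
    (hne : t ≠ t') (n : ℕ) : IsSet E (codedRel E t (n + 1) t' n E) := by
  induction n with
  | zero => exact h.codedRel_mem ht
  | succ n ih => exact h.codedRel_succ ht ht' hne ih

/-- If `M` were finite, each subset would be an extension, contradicting Cantor's theorem. -/
theorem infinite [Nonempty M] : Infinite M := by
  by_contra hfin
  rw [not_infinite_iff_finite] at hfin
  choose g hg using fun A : Set M => h.of_finite A.toFinite
  exact Function.cantor_injective g fun A B hAB => by rw [← hg A, ← hg B, hAB]

theorem exists_tags [Nonempty M] : ∃ g : ℕ → M, Function.Injective g ∧ ∀ n, IsTag E (g n) := by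
  have := h.infinite
  obtain ⟨a⟩ : Nonempty (ℕ ↪ M) := ⟨Infinite.natEmbedding M⟩
  choose g hg using fun A : Finset M => h.of_finite A.finite_toSet
  have hinj : Function.Injective g := fun A B hAB => by
    rw [← Finset.coe_inj, ← hg A, ← hg B, hAB]
  -- Cardinality `n + 3` separates the tags from each other and from all pairs.
  refine ⟨fun n => g ((Finset.range (n + 3)).map a), fun m n hmn => ?_, fun n x y hxy => ?_⟩
  · have := congrArg Finset.card (hinj hmn)
    simpa using this
  · rw [hg] at hxy
    have := congrArg Set.ncard hxy
    rw [Set.ncard_coe_finset, Finset.card_map, Finset.card_range] at this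
    have := Set.ncard_insert_le x {y}
    rw [Set.ncard_singleton] at this
    omega

end SixClosed
end Codes

/-! ### Relations of several variables as sets of coded tuples -/

section Tuples

variable {M : Type*} {E : M → M → Prop}

/-- The relation `P` on tuples, transported to sets of codes; the code of the `i`-th entry has
the tag `t i` and the level `k i + 1`. -/
def codedTuples {ι : Type*} (E : M → M → Prop) (t : ι → M) (k : ι → ℕ) (P : (ι → M) → Prop) :
    Set M :=
  {y | ∃ e v : ι → M, (∀ i, Code E (t i) (k i + 1) (e i) (v i)) ∧ P v ∧ ext E y = Set.range e}

variable {ι κ : Type*} {t : ι → M} {k : ι → ℕ}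

theorem code_index_unique (ht : ∀ i, IsTag E (t i)) (hinj : Function.Injective t) {i j : ι}
    {e x x' : M} (hi : Code E (t i) (k i + 1) e x) (hj : Code E (t j) (k j + 1) e x') : i = j :=
  hinj (hi.tag_unique (ht i) hj)

theorem codedTuples_unique (ht : ∀ i, IsTag E (t i)) (hinj : Function.Injective t)
    {e e' v v' : ι → M} (he : ∀ i, Code E (t i) (k i + 1) (e i) (v i))
    (he' : ∀ i, Code E (t i) (k i + 1) (e' i) (v' i)) (hr : Set.range e ⊆ Set.range e') :
    e = e' ∧ v = v' := by
  have key : ∀ i, e i = e' i := fun i => by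
    obtain ⟨j, hj⟩ := hr ⟨i, rfl⟩
    obtain rfl : i = j := code_index_unique (k := k) ht hinj (he i) (hj ▸ he' j)
    exact hj.symm
  refine ⟨funext key, funext fun i => ?_⟩
  have := he' i
  rw [← key i] at this
  exact (he i).unique (ht i) this

namespace SixClosed

variable [Nonempty M] (h : SixClosed E)
include h

/-- A coded tuple is a set of codes having exactly one element in each class of codes. "At most one"
is expressed as inclusion in `r` plus the complement of the class, where `r` has at most one
element. -/
theorem tuples_true [Finite ι] (ht : ∀ i, IsTag E (t i)) (hinj : Function.Injective t) :
    IsSet E (codedTuples E t k fun _ => True) := by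
  classical
  have := Fintype.ofFinite ι
  have hD := fun i => h.all_codes (t i) (k i + 1)
  have h1 := h.biInter Finset.univ _ fun i => h.inter₂ (h.meets (hD i))
    (h.below h.subsing (h.compl (hD i)))
  have h2 := h.powerset (h.biUnion Finset.univ _ hD)
  refine (h.inter₂ h1 h2).congr fun y => ?_
  constructor
  · rintro ⟨e, v, hev, -, hy⟩
    refine ⟨fun i _ => ⟨⟨e i, ⟨v i, hev i⟩, by simp [hy]⟩, ?_⟩, ?_⟩
    · obtain ⟨r, hr⟩ := h.singleton (e i)
      refine ⟨r, ⟨e i, hr.le⟩, ?_⟩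
      rw [hy, hr]
      rintro _ ⟨j, rfl⟩
      by_cases hij : j = i
      · exact Or.inl (by simp [hij])
      · refine Or.inr ?_
        rintro ⟨x, hx⟩
        exact hij (code_index_unique (k := k) ht hinj (hev j) hx)
    · rw [Set.mem_ofPred_eq, hy]
      rintro _ ⟨j, rfl⟩
      exact ⟨j, Finset.mem_univ j, v j, hev j⟩
  · rintro ⟨hy1, hy2⟩
    choose e he hey using fun i => (hy1 i (Finset.mem_univ i)).1
    choose v hv using he
    refine ⟨e, v, hv, trivial, Set.Subset.antisymm (fun m hm => ?_) ?_⟩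
    · obtain ⟨i, -, x, hx⟩ := hy2 hm
      obtain ⟨r, ⟨z, hz⟩, hyr⟩ := (hy1 i (Finset.mem_univ i)).2
      have hmz : m = z := hz ((hyr hm).resolve_right fun hn => hn ⟨x, hx⟩)
      have hez : e i = z := hz ((hyr (hey i)).resolve_right fun hn => hn ⟨v i, hv i⟩)
      exact ⟨i, hez.trans hmz.symm⟩
    · rintro _ ⟨i, rfl⟩
      exact hey i

theorem tuples_false : IsSet E (codedTuples E t k fun _ => False) :=
  h.empty.congr fun y => by simp [codedTuples]

theorem tuples_not [Finite ι] (ht : ∀ i, IsTag E (t i)) (hinj : Function.Injective t)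
    {P : (ι → M) → Prop} (hP : IsSet E (codedTuples E t k P)) :
    IsSet E (codedTuples E t k fun v => ¬ P v) := by
  refine (h.sdiff (h.tuples_true (k := k) ht hinj) hP).congr fun y => ?_
  constructor
  · rintro ⟨e, v, hev, hv, hy⟩
    refine ⟨⟨e, v, hev, trivial, hy⟩, ?_⟩
    rintro ⟨e', v', hev', hv', hy'⟩
    obtain ⟨-, rfl⟩ := codedTuples_unique ht hinj hev hev' (hy.symm.trans hy').le
    exact hv hv'
  · rintro ⟨⟨e, v, hev, -, hy⟩, hn⟩
    exact ⟨e, v, hev, fun hv => hn ⟨e, v, hev, hv, hy⟩, hy⟩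

theorem tuples_imp [Finite ι] (ht : ∀ i, IsTag E (t i)) (hinj : Function.Injective t)
    {P Q : (ι → M) → Prop} (hP : IsSet E (codedTuples E t k P))
    (hQ : IsSet E (codedTuples E t k Q)) : IsSet E (codedTuples E t k fun v => P v → Q v) := by
  refine (h.union (h.tuples_not ht hinj hP) hQ).congr fun y => ?_
  constructor
  · rintro ⟨e, v, hev, hv, hy⟩
    by_cases hPv : P v
    · exact Or.inr ⟨e, v, hev, hv hPv, hy⟩
    · exact Or.inl ⟨e, v, hev, hPv, hy⟩
  · rintro (⟨e, v, hev, hv, hy⟩ | ⟨e, v, hev, hv, hy⟩)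
    · exact ⟨e, v, hev, fun hn => absurd hn hv, hy⟩
    · exact ⟨e, v, hev, fun _ => hv, hy⟩

/-- Forgetting entries of a tuple is passing to a subset of its set of codes. -/
theorem tuples_exists [Finite ι] [Finite κ] (ht : ∀ i, IsTag E (t i)) (hinj : Function.Injective t)
    {f : κ → ι} (hf : Function.Injective f) {P : (ι → M) → Prop}
    (hP : IsSet E (codedTuples E t k P)) :
    IsSet E (codedTuples E (t ∘ f) (k ∘ f) fun v => ∃ w, w ∘ f = v ∧ P w) := by
  classical
  refine (h.inter₂ (h.below hP h.empty) (h.tuples_true (k := k ∘ f) (fun i => ht (f i))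
    (hinj.comp hf))).congr fun y => ?_
  constructor
  · rintro ⟨e, _, hev, ⟨w, rfl, hw⟩, hy⟩
    choose e' he' using fun i => h.exists_code (t i) (k i + 1) (w i)
    -- Codes are not unique, so those already in `y` are kept and new ones are chosen only outside
    -- the range of `f`.
    have hext : ∃ e'' : ι → M, (∀ i, Code E (t i) (k i + 1) (e'' i) (w i)) ∧ e'' ∘ f = e := by
      refine ⟨Function.extend f e e', fun i => ?_, funext fun j => hf.extend_apply _ _ _⟩
      by_cases hi : ∃ j, f j = i
      · obtain ⟨j, rfl⟩ := hi
        rw [hf.extend_apply]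
        exact hev j
      · rw [Function.extend_apply' _ _ _ hi]
        exact he' i
    obtain ⟨e'', he'', rfl⟩ := hext
    obtain ⟨r, hr⟩ := h.of_finite (Set.finite_range e'')
    refine ⟨⟨r, ⟨e'', w, he'', hw, hr⟩, ?_⟩, e'' ∘ f, w ∘ f, hev, trivial, hy⟩
    rw [hy, hr, Set.union_empty]
    exact Set.range_comp_subset_range f e''
  · rintro ⟨⟨r, ⟨e', w, hew, hw, hr⟩, hyr⟩, e, v, hev, -, hy⟩
    refine ⟨e, v, hev, ⟨w, ?_, hw⟩, hy⟩
    rw [hy, hr, Set.union_empty] at hyr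
    funext i
    obtain ⟨j, hj⟩ := hyr ⟨i, rfl⟩
    have hi := hev i
    obtain rfl : f i = j := code_index_unique (k := k) ht hinj hi (hj ▸ hew j)
    have := hew (f i)
    rw [hj] at this
    exact this.unique (ht _) hi

/-- The tuple lies below a pair of the relation together with arbitrary codes for the other indices;
the tags then force the pair to consist of the entries `i` and `j`. -/
theorem tuples_pair [Finite ι] (ht : ∀ i, IsTag E (t i)) (hinj : Function.Injective t)
    {i j : ι} (hij : i ≠ j) {φ : M → M → Prop}
    (hφ : IsSet E (codedRel E (t i) (k i + 1) (t j) (k j + 1) φ)) :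
    IsSet E (codedTuples E t k fun v => φ (v i) (v j)) := by
  classical
  have := Fintype.ofFinite ι
  have hD := h.biUnion (Finset.univ \ {i, j}) _ fun l => h.all_codes (t l) (k l + 1)
  refine (h.inter₂ (h.below hφ hD) (h.tuples_true (k := k) ht hinj)).congr fun y => ?_
  constructor
  · rintro ⟨e, v, hev, hv, hy⟩
    obtain ⟨r, hr⟩ := h.pair (e i) (e j)
    refine ⟨⟨r, ⟨e i, ⟨v i, hev i⟩, e j, ⟨v j, hev j⟩, ⟨v i, v j, hev i, hev j, hv⟩, hr⟩, ?_⟩,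
      e, v, hev, trivial, hy⟩
    rw [hy, hr]
    rintro _ ⟨l, rfl⟩
    by_cases hl : l = i ∨ l = j
    · left
      rcases hl with rfl | rfl <;> simp
    · exact Or.inr ⟨l, by simpa using hl, v l, hev l⟩
  · rintro ⟨⟨r, ⟨a, -, b, -, ⟨x, x', hx, hx', hxx⟩, hr⟩, hyr⟩, e, v, hev, -, hy⟩
    refine ⟨e, v, hev, ?_, hy⟩
    rw [hy, hr] at hyr
    have key : ∀ l, l = i ∨ l = j → e l = a ∨ e l = b := fun l hl => by
      rcases hyr ⟨l, rfl⟩ with hm | ⟨m, hm, z, hz⟩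
      · simpa using hm
      · obtain rfl := code_index_unique (k := k) ht hinj (hev l) hz
        simp at hm
        tauto
    have e1 : e i = a := (key i (Or.inl rfl)).resolve_right fun he =>
      hij (code_index_unique (k := k) ht hinj (hev i) (he ▸ hx'))
    have e2 : e j = b := (key j (Or.inr rfl)).resolve_left fun he =>
      hij (code_index_unique (k := k) ht hinj (he ▸ hx) (hev j))
    obtain rfl : v i = x := (hev i).unique (ht i) (e1 ▸ hx)
    obtain rfl : v j = x' := (hev j).unique (ht j) (e2 ▸ hx')
    exact hxx

/-- Fixing all entries but one leaves a set. -/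
theorem of_tuples [Finite ι] (ht : ∀ i, IsTag E (t i)) (hinj : Function.Injective t) (j : ι)
    {P : (ι → M) → Prop} (hP : IsSet E (codedTuples E t k P)) (p : ι → M) :
    IsSet E {x | ∃ v, (∀ i, i ≠ j → v i = p i) ∧ v j = x ∧ P v} := by
  classical
  have := Fintype.ofFinite ι
  -- This selects the tuples with the prescribed entries off `j`. The union of those satisfying `P`,
  -- cut down to codes with tag `t j`, is the set of codes of the required elements.
  have h1 := h.biInter (Finset.univ \ {j}) _ fun i =>
    h.meets (h.codes (t i) (k i + 1) (h.singleton (p i)))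
  refine h.of_codes (ht j) (n := k j + 1) ((h.inter₂ (h.sUnion (h.inter₂ hP h1))
    (h.all_codes (t j) (k j + 1))).congr fun a => ?_)
  constructor
  · rintro ⟨_, ⟨v, hvp, rfl, hv⟩, ha⟩
    choose e he using fun i => h.exists_code (t i) (k i + 1) (v i)
    set e' := Function.update e j a with e'_def
    have he' : ∀ i, Code E (t i) (k i + 1) (e' i) (v i) := fun i => by
      by_cases hi : i = j
      · subst hi
        simpa [e'_def] using ha
      · simpa [e'_def, hi] using he i
    obtain ⟨y, hy⟩ := h.of_finite (Set.finite_range e')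
    refine ⟨⟨y, ⟨⟨e', v, he', hv, hy⟩, fun i hi => ⟨e' i, ⟨p i, rfl, ?_⟩, by simp [hy]⟩⟩, ?_⟩,
      v j, ha⟩
    · rw [← hvp i (by simpa using hi)]
      exact he' i
    · rw [hy]
      exact ⟨j, by simp [e'_def]⟩
  · rintro ⟨⟨y, ⟨⟨e, v, hev, hv, hy⟩, hyp⟩, hay⟩, x, hx⟩
    rw [hy] at hay
    obtain ⟨l, rfl⟩ := hay
    obtain rfl : l = j := code_index_unique (k := k) ht hinj (hev l) hx
    refine ⟨v l, ⟨v, fun i hi => ?_, rfl, hv⟩, hev l⟩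
    obtain ⟨b, ⟨_, rfl, hb⟩, hby⟩ := hyp i (by simpa using hi)
    rw [hy] at hby
    obtain ⟨m, rfl⟩ := hby
    obtain rfl : m = i := code_index_unique (k := k) ht hinj (hev m) hb
    exact (hev m).unique (ht m) hb

end SixClosed
end Tuples

open FirstOrder.Language

/-! ### Meaning of the axioms in a structure -/

section Semantics

variable {M : Type*} [L.Structure M]

/-- The interpretation of `∈`. -/
def Mem (M : Type*) [L.Structure M] (x y : M) : Prop :=
  Structure.RelMap (L := L) (M := M) (n := 2) MemSymbol.mem ![x, y]

/-- The formula `s ∈ t`, for terms `s` and `t`. -/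
def memT {α : Type} {n : ℕ} (s t : L.Term (α ⊕ Fin n)) : L.BoundedFormula α n :=
  Relations.boundedFormula₂ (L := L) MemSymbol.mem s t

variable {α : Type} {n : ℕ}

theorem realize_memT (s t : L.Term (α ⊕ Fin n)) (v : α → M) (xs : Fin n → M) :
    (memT s t).Realize v xs ↔
      Mem M (s.realize (Sum.elim v xs)) (t.realize (Sum.elim v xs)) :=
  BoundedFormula.realize_rel₂

theorem realize_memF (x y : Fin n) (v : α → M) (xs : Fin n → M) :
    (memF x y).Realize v xs ↔ Mem M (xs x) (xs y) :=
  BoundedFormula.realize_rel₂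

theorem realize_eqF (x y : Fin n) (v : α → M) (xs : Fin n → M) :
    (eqF x y).Realize v xs ↔ xs x = xs y := by
  simp [eqF]

theorem realize_pairF (x a b : Fin n) (v : α → M) (xs : Fin n → M) :
    (pairF x a b).Realize v xs ↔ ∀ z, Mem M z (xs x) ↔ z = xs a ∨ z = xs b := by
  simp [pairF, realize_memF, realize_eqF, BoundedFormula.realize_iff]

theorem realize_complementsAx :
    M ⊨ complementsAx ↔ ∀ A : M, ∃ x, ∀ y, Mem M y x ↔ ¬ Mem M y A := by
  simp [complementsAx, Sentence.Realize, Formula.Realize, realize_memF, Fin.snoc,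
    BoundedFormula.realize_iff]

theorem realize_pairingAx :
    M ⊨ pairingAx ↔ ∀ a b : M, ∃ x, ∀ y, Mem M y x ↔ y = a ∨ y = b := by
  simp [pairingAx, Sentence.Realize, Formula.Realize, realize_memF, realize_eqF, Fin.snoc,
    BoundedFormula.realize_iff]

theorem realize_setUnionAx :
    M ⊨ setUnionAx ↔ ∀ A : M, ∃ x, ∀ y, Mem M y x ↔ ∃ m, Mem M m A ∧ Mem M y m := by
  simp [setUnionAx, Sentence.Realize, Formula.Realize, realize_memF, Fin.snoc,
    BoundedFormula.realize_iff]

theorem realize_fregeOneStarAx :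
    M ⊨ fregeOneStarAx ↔ ∃ x : M, ∀ y, Mem M y x ↔ ∃ z, ∀ m, Mem M m y → m = z := by
  simp [fregeOneStarAx, Sentence.Realize, Formula.Realize, realize_memF, realize_eqF, Fin.snoc,
    BoundedFormula.realize_iff]

theorem realize_preproductAx :
    M ⊨ preproductAx ↔ ∀ R S : M, ∃ x, ∀ y, Mem M y x ↔ ∃ r, Mem M r R ∧ ∃ s, Mem M s S ∧
      ∀ z, Mem M z y → (Mem M z s ∨ Mem M z r) := by
  simp [preproductAx, Sentence.Realize, Formula.Realize, realize_memF, Fin.snoc,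
    BoundedFormula.realize_iff]

theorem realize_intersectionRelationAx :
    M ⊨ intersectionRelationAx ↔ ∃ x : M, ∀ y, Mem M y x ↔ ∃ z, ∀ m, Mem M m y → Mem M z m := by
  simp [intersectionRelationAx, Sentence.Realize, Formula.Realize, realize_memF, Fin.snoc,
    BoundedFormula.realize_iff]

theorem realize_compositionAx :
    M ⊨ compositionAx ↔ ∀ R S : M, ∃ X, ∀ y, Mem M y X ↔ ∃ a b c r s,
      (∀ z, Mem M z y ↔ z = a ∨ z = c) ∧ Mem M r R ∧ Mem M s S ∧
      (∀ z, Mem M z r ↔ z = a ∨ z = b) ∧ (∀ z, Mem M z s ↔ z = b ∨ z = c) := by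
  simp [compositionAx, Sentence.Realize, Formula.Realize, realize_memF, realize_pairF, Fin.snoc,
    BoundedFormula.realize_iff, and_assoc]

theorem realize_comprehension (m : ℕ) (φ : L.Formula (Fin m ⊕ Unit)) :
    M ⊨ comprehension m φ ↔ ∀ p : Fin m → M, ∃ x, ∀ y, Mem M y x ↔
      φ.Realize (Sum.elim p fun _ => y) := by
  rw [comprehension, Sentence.Realize, BoundedFormula.realize_alls]
  refine forall_congr' fun p => ?_
  rw [BoundedFormula.realize_ex]
  refine exists_congr fun x => ?_
  rw [BoundedFormula.realize_all]
  refine forall_congr' fun y => ?_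
  rw [BoundedFormula.realize_iff, realize_memF, BoundedFormula.realize_relabel, Formula.Realize]
  have h1 : (Fin.snoc (Fin.snoc p x) y : Fin (m + 2) → M) (Fin.last (m + 1)) = y := by simp
  have h2 : (Fin.snoc (Fin.snoc p x) y : Fin (m + 2) → M) (Fin.last m).castSucc = x := by simp
  rw [h1, h2]
  refine iff_congr Iff.rfl (iff_of_eq ?_)
  congr 1
  · funext i
    rcases i with i | i <;> simp
  · exact Subsingleton.elim _ _

theorem models_sixAxioms_iff : M ⊨ sixAxioms ↔ SixClosed (Mem M) := by
  have hset : ∀ A : Set M, IsSet (Mem M) A ↔ ∃ x, ∀ y, Mem M y x ↔ y ∈ A := fun A => by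
    simp [IsSet, ext, Set.ext_iff]
  simp only [sixAxioms, model_insert_iff, model_singleton_iff,
    realize_complementsAx, realize_pairingAx, realize_setUnionAx, realize_fregeOneStarAx,
    realize_preproductAx, realize_intersectionRelationAx]
  constructor
  · rintro ⟨h1, h2, h3, h4, h5, h6⟩
    refine ⟨?_, ?_, ?_, ?_, ?_, ?_⟩
    · rintro _ ⟨a, rfl⟩
      exact (hset _).2 (h1 a)
    · intro a b
      exact (hset _).2 (h2 a b)
    · rintro _ ⟨a, rfl⟩
      exact (hset _).2 (h3 a)
    · exact (hset _).2 h4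
    · rintro _ _ ⟨a, rfl⟩ ⟨b, rfl⟩
      exact (hset _).2 (h5 a b)
    · exact (hset _).2 h6
  · intro h
    refine ⟨fun a => ?_, fun a b => ?_, fun a => ?_, ?_, fun a b => ?_, ?_⟩
    · exact (hset _).1 (h.compl ⟨a, rfl⟩)
    · exact (hset _).1 (h.pair a b)
    · exact (hset _).1 (h.sUnion ⟨a, rfl⟩)
    · exact (hset _).1 h.subsing
    · exact (hset _).1 (h.pre ⟨a, rfl⟩ ⟨b, rfl⟩)
    · exact (hset _).1 h.inter

end Semantics

/-! ### Stratified comprehension from the six axioms, and conversely -/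

section Comprehension

variable {M : Type*} [L.Structure M] {α : Type}

theorem exists_eq_var {n : ℕ} (s : L.Term (α ⊕ Fin n)) : ∃ i, s = .var i := by
  cases s with
  | var i => exact ⟨i, rfl⟩
  | func g _ => exact Empty.elim g

/-- Levels decrease as types increase. The bound `N` must also dominate the types of quantified
variables, which come to light only in the induction; allowing all large `N` gives the two sides of
an implication a common one. -/
theorem SixClosed.tuples_formula [Nonempty M] [Finite α] (h : SixClosed (Mem M)) {g : α ⊕ ℕ → M}
    (hg : Function.Injective g) (hgt : ∀ i, IsTag (Mem M) (g i)) (f : α → ℕ) {n : ℕ}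
    (φ : L.BoundedFormula α n) (b : Fin n → ℕ) (hφ : StratifiedBy f b φ) :
    ∃ N₀, ∀ N ≥ N₀, (∀ i, Sum.elim f b i ≤ N) →
      IsSet (Mem M) (codedTuples (Mem M) (fun i => g (Sum.map id Fin.val i))
        (fun i => N - Sum.elim f b i) fun v => φ.Realize (v ∘ Sum.inl) (v ∘ Sum.inr)) := by
  have hti : ∀ n, Function.Injective fun i : α ⊕ Fin n => g (Sum.map id Fin.val i) := fun n =>
    hg.comp (Function.injective_id.sumMap Fin.val_injective)
  have htt : ∀ n, ∀ i : α ⊕ Fin n, IsTag (Mem M) (g (Sum.map id Fin.val i)) := fun n i => hgt _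
  have helim : ∀ {n} (v : α ⊕ Fin n → M), Sum.elim (v ∘ Sum.inl) (v ∘ Sum.inr) = v :=
    fun v => Sum.elim_comp_inl_inr v
  induction φ with
  | falsum => exact ⟨0, fun N _ _ => h.tuples_false⟩
  | @equal n s t =>
    obtain ⟨i, rfl⟩ := exists_eq_var s
    obtain ⟨j, rfl⟩ := exists_eq_var t
    refine ⟨0, fun N _ hN => ?_⟩
    have hty : Sum.elim f b i = Sum.elim f b j := hφ
    have hreal : ∀ v : α ⊕ Fin n → M, (BoundedFormula.equal (L := L) (.var i) (.var j)).Realize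
        (v ∘ Sum.inl) (v ∘ Sum.inr) ↔ v i = v j := fun v => by
      simp [BoundedFormula.Realize, helim]
    simp only [hreal]
    by_cases hij : i = j
    · subst hij
      simpa using h.tuples_true (htt n) (hti n)
    · refine h.tuples_pair (htt n) (hti n) hij (φ := Eq) ?_
      simp only [hty]
      exact h.codedRel_eq_level (hgt _) (hgt _) (fun e => hij (hti n e)) _
  | @rel n l R ts =>
    cases R
    obtain ⟨i, hi⟩ := exists_eq_var (ts 0)
    obtain ⟨j, hj⟩ := exists_eq_var (ts 1)
    refine ⟨0, fun N _ hN => ?_⟩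
    have hty : Sum.elim f b j = Sum.elim f b i + 1 := by
      have : termType f b (ts 1) = termType f b (ts 0) + 1 := hφ
      rwa [hi, hj] at this
    have hreal : ∀ v : α ⊕ Fin n → M, (BoundedFormula.rel (L := L) MemSymbol.mem ts).Realize
        (v ∘ Sum.inl) (v ∘ Sum.inr) ↔ Mem M (v i) (v j) := fun v => by
      have : (fun k => (ts k).realize v) = ![v i, v j] := by
        funext k
        fin_cases k <;> simp [hi, hj]
      simp only [BoundedFormula.Realize, helim, this, Mem]
    simp only [hreal]
    -- `x ∈ x` is not stratified.
    have hij : i ≠ j := by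
      rintro rfl
      omega
    refine h.tuples_pair (htt n) (hti n) hij (φ := Mem M) ?_
    -- The bound on types keeps the truncated subtraction exact here.
    have hlev : N - Sum.elim f b i = N - Sum.elim f b j + 1 := by
      have := hN j
      omega
    simp only [hlev]
    exact h.codedRel_mem_level (hgt _) (hgt _) (fun e => hij (hti n e)) _
  | imp φ ψ ihφ ihψ =>
    obtain ⟨N₁, h₁⟩ := ihφ b hφ.1
    obtain ⟨N₂, h₂⟩ := ihψ b hφ.2
    exact ⟨max N₁ N₂, fun N hN hb => h.tuples_imp (htt _) (hti _)
      (h₁ N (le_of_max_le_left hN) hb) (h₂ N (le_of_max_le_right hN) hb)⟩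
  | @all n φ ih =>
    obtain ⟨k, hk⟩ := hφ
    obtain ⟨N₀, h₀⟩ := ih _ hk
    refine ⟨max N₀ k, fun N hN hb => ?_⟩
    have hb' : ∀ i, Sum.elim f (Fin.snoc (α := fun _ => ℕ) b k) i ≤ N := by
      rintro (i | i)
      · exact hb (.inl i)
      · refine Fin.lastCases ?_ (fun i => ?_) i
        · simpa using le_of_max_le_right hN
        · simpa using hb (.inr i)
    have hinj : Function.Injective (Sum.map id Fin.castSucc : α ⊕ Fin n → α ⊕ Fin (n + 1)) :=
      Function.injective_id.sumMap (Fin.castSucc_injective n)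
    have key := h.tuples_exists (htt _) (hti _) hinj
      (h.tuples_not (htt _) (hti _) (h₀ N (le_of_max_le_left hN) hb'))
    have e1 : (fun i => g (Sum.map id Fin.val i)) ∘
        (Sum.map id Fin.castSucc : α ⊕ Fin n → α ⊕ Fin (n + 1)) =
        fun i => g (Sum.map id Fin.val i) := by
      funext i
      rcases i with i | i <;> simp
    have e2 : (fun i => N - Sum.elim f (Fin.snoc (α := fun _ => ℕ) b k) i) ∘
        (Sum.map id Fin.castSucc : α ⊕ Fin n → α ⊕ Fin (n + 1)) =
        fun i => N - Sum.elim f b i := by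
      funext i
      rcases i with i | i <;> simp
    rw [e1, e2] at key
    have hreal : ∀ v : α ⊕ Fin n → M, φ.all.Realize (v ∘ Sum.inl) (v ∘ Sum.inr) ↔
        ¬ ∃ w : α ⊕ Fin (n + 1) → M, w ∘ Sum.map id Fin.castSucc = v ∧
          ¬ φ.Realize (w ∘ Sum.inl) (w ∘ Sum.inr) := fun v => by
      simp only [BoundedFormula.Realize, not_exists, not_and, not_not]
      constructor
      · rintro hv w rfl
        have e3 : Fin.snoc (α := fun _ => M) ((w ∘ Sum.map id Fin.castSucc) ∘ Sum.inr)
            (w (.inr (Fin.last n))) = w ∘ Sum.inr := by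
          funext i
          refine Fin.lastCases ?_ (fun i => ?_) i <;> simp
        have := hv (w (.inr (Fin.last n)))
        rw [e3] at this
        exact this
      · intro hw x
        have := hw (Sum.elim (v ∘ Sum.inl) (Fin.snoc (v ∘ Sum.inr) x)) (by
          funext i
          rcases i with i | i <;> simp)
        simpa using this
    simp only [hreal]
    exact h.tuples_not (htt _) (hti _) key

theorem SixClosed.comprehension [Nonempty M] (h : SixClosed (Mem M)) {m : ℕ}
    {φ : L.Formula (Fin m ⊕ Unit)} (hφ : Stratified φ) (p : Fin m → M) :
    IsSet (Mem M) {y | φ.Realize (Sum.elim p fun _ => y)} := by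
  obtain ⟨f, hf⟩ := hφ
  obtain ⟨g, hg, hgt⟩ := h.exists_tags
  -- The variables are numbered so that each receives its own tag.
  obtain ⟨e⟩ : Nonempty ((Fin m ⊕ Unit) ⊕ ℕ ↪ ℕ) := nonempty_embedding_nat _
  obtain ⟨N₀, hN⟩ := h.tuples_formula (hg.comp e.injective) (fun i => hgt (e i)) f φ _ hf
  obtain ⟨N₁, hN₁⟩ := Finite.exists_le (Sum.elim f (Fin.elim0 : Fin 0 → ℕ))
  have key := h.of_tuples (fun i => hgt _) ((hg.comp e.injective).comp
    (Function.injective_id.sumMap Fin.val_injective)) (.inl (.inr ()))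
    (hN (max N₀ N₁) (le_max_left _ _) fun i => (hN₁ i).trans (le_max_right _ _))
    -- The value at the element variable is a dummy: that entry is the one left free.
    (Sum.elim (Sum.elim p fun _ => Classical.arbitrary M) Fin.elim0)
  refine key.congr fun y => ?_
  have hre : ∀ v : (Fin m ⊕ Unit) ⊕ Fin 0 → M,
      BoundedFormula.Realize φ (v ∘ Sum.inl) (v ∘ Sum.inr) ↔ φ.Realize (v ∘ Sum.inl) := fun v => by
    rw [Formula.Realize, Subsingleton.elim (v ∘ Sum.inr) default]
  constructor
  · intro hy
    refine ⟨Sum.elim (Sum.elim p fun _ => y) Fin.elim0, ?_, rfl, ?_⟩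
    · rintro ((i | i) | i) hi
      · rfl
      · exact absurd rfl hi
      · exact i.elim0
    · rw [hre]
      exact hy
  · rintro ⟨v, hv, rfl, hφv⟩
    rw [hre] at hφv
    have : (Sum.elim p fun _ => v (.inl (.inr ()))) = v ∘ Sum.inl := by
      funext i
      rcases i with i | i
      · exact (hv (.inl (.inl i)) (by simp)).symm
      · rfl
    rw [Set.mem_ofPred_eq, this]
    exact hφv

theorem models_SF_of_sixClosed [Nonempty M] (h : SixClosed (Mem M)) : M ⊨ SF := by
  rw [model_iff]
  rintro _ ⟨m, φ, hφ, rfl⟩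
  rw [realize_comprehension]
  intro p
  obtain ⟨x, hx⟩ := h.comprehension hφ p
  exact ⟨x, fun y => Set.ext_iff.1 hx y⟩

theorem comprehension_of_models_SF (h : M ⊨ SF) {m : ℕ} (φ : L.Formula (Fin m ⊕ Unit))
    (hφ : Stratified φ) (p : Fin m → M) :
    ∃ x, ∀ y, Mem M y x ↔ φ.Realize (Sum.elim p fun _ => y) :=
  (realize_comprehension m φ).1 ((model_iff SF).1 h _ ⟨m, φ, hφ, rfl⟩) p

variable (f : α → ℕ) {n : ℕ} (b : Fin n → ℕ)

@[simp] theorem stratifiedBy_memT (s t : L.Term (α ⊕ Fin n)) :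
    StratifiedBy f b (memT s t) ↔ termType f b t = termType f b s + 1 := Iff.rfl

@[simp] theorem stratifiedBy_bdEqual (s t : L.Term (α ⊕ Fin n)) :
    StratifiedBy f b (s.bdEqual t) ↔ termType f b s = termType f b t := Iff.rfl

@[simp] theorem stratifiedBy_imp (φ ψ : L.BoundedFormula α n) :
    StratifiedBy f b (φ.imp ψ) ↔ StratifiedBy f b φ ∧ StratifiedBy f b ψ := Iff.rfl

@[simp] theorem stratifiedBy_not (φ : L.BoundedFormula α n) :
    StratifiedBy f b φ.not ↔ StratifiedBy f b φ := and_iff_left trivial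

@[simp] theorem stratifiedBy_sup (φ ψ : L.BoundedFormula α n) :
    StratifiedBy f b (φ ⊔ ψ) ↔ StratifiedBy f b φ ∧ StratifiedBy f b ψ := by
  change StratifiedBy f b (φ.not.imp ψ) ↔ _
  simp

@[simp] theorem stratifiedBy_inf (φ ψ : L.BoundedFormula α n) :
    StratifiedBy f b (φ ⊓ ψ) ↔ StratifiedBy f b φ ∧ StratifiedBy f b ψ := by
  change StratifiedBy f b (φ.imp ψ.not).not ↔ _
  simp

@[simp] theorem stratifiedBy_iff (φ ψ : L.BoundedFormula α n) :
    StratifiedBy f b (φ.iff ψ) ↔ StratifiedBy f b φ ∧ StratifiedBy f b ψ := by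
  change StratifiedBy f b ((φ.imp ψ) ⊓ (ψ.imp φ)) ↔ _
  simp
  tauto

@[simp] theorem stratifiedBy_all (φ : L.BoundedFormula α (n + 1)) :
    StratifiedBy f b φ.all ↔ ∃ k : ℕ, StratifiedBy f (Fin.snoc b k) φ := Iff.rfl

@[simp] theorem stratifiedBy_ex (φ : L.BoundedFormula α (n + 1)) :
    StratifiedBy f b φ.ex ↔ ∃ k : ℕ, StratifiedBy f (Fin.snoc b k) φ := by
  change StratifiedBy f b φ.not.all.not ↔ _
  simp

@[simp] theorem termType_var (i : α ⊕ Fin n) :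
    termType f b (.var i) = Sum.elim f b i := rfl

/-- The `i`-th parameter of a comprehension formula. -/
abbrev paramVar {m n : ℕ} (i : Fin m) : L.Term ((Fin m ⊕ Unit) ⊕ Fin n) := .var (.inl (.inl i))

/-- The variable for the elements of the set that a comprehension formula defines. -/
abbrev elemVar {m n : ℕ} : L.Term ((Fin m ⊕ Unit) ⊕ Fin n) := .var (.inl (.inr ()))

theorem realize_formula {β : Type} (φ : L.BoundedFormula β 0) (v : β → M) :
    Formula.Realize φ v ↔ BoundedFormula.Realize φ v default := Iff.rfl

/-- Each axiom is an instance of comprehension; the functions supplied give types to the parameters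
and to the element variable, chosen so that the innermost variables get type 0. -/
theorem sixClosed_of_models_SF (h : M ⊨ SF) : SixClosed (Mem M) := by
  rw [← models_sixAxioms_iff]
  simp only [sixAxioms, model_insert_iff, model_singleton_iff,
    realize_complementsAx, realize_pairingAx, realize_setUnionAx, realize_fregeOneStarAx,
    realize_preproductAx, realize_intersectionRelationAx]
  refine ⟨fun A => ?_, fun a b => ?_, fun A => ?_, ?_, fun R S => ?_, ?_⟩
  · have := comprehension_of_models_SF h (m := 1) (∼(memT elemVar (paramVar 0)))
      ⟨Sum.elim ![1] (fun _ => 0), by simp⟩ ![A]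
    simpa [realize_formula, realize_memT] using this
  · have := comprehension_of_models_SF h (m := 2)
      (Term.bdEqual elemVar (paramVar 0) ⊔ Term.bdEqual elemVar (paramVar 1))
      ⟨fun _ => 0, by simp⟩ ![a, b]
    simpa [realize_formula] using this
  · have := comprehension_of_models_SF h (m := 1)
      (∃' (memT (&0) (paramVar 0) ⊓ memT elemVar (&0)))
      ⟨Sum.elim ![2] (fun _ => 0), by simp [Fin.snoc]⟩ ![A]
    simpa [realize_formula, realize_memT, Fin.snoc] using this
  · have := comprehension_of_models_SF h (m := 0)
      (∃' ∀' (memT (&1) elemVar ⟹ Term.bdEqual (&1) (&0)))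
      ⟨fun _ => 1, by simp [Fin.snoc]⟩ ![]
    simpa [realize_formula, realize_memT, Fin.snoc] using this
  · have := comprehension_of_models_SF h (m := 2)
      (∃' (memT (&0) (paramVar 0) ⊓ ∃' (memT (&1) (paramVar 1) ⊓
        ∀' (memT (&2) elemVar ⟹ (memT (&2) (&1) ⊔ memT (&2) (&0))))))
      ⟨Sum.elim (fun _ => 2) (fun _ => 1), by simp [Fin.snoc]⟩ ![R, S]
    simpa [realize_formula, realize_memT, Fin.snoc] using this
  · have := comprehension_of_models_SF h (m := 0)
      (∃' ∀' (memT (&1) elemVar ⟹ memT (&0) (&1)))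
      ⟨fun _ => 2, by simp [Fin.snoc]⟩ ![]
    simpa [realize_formula, realize_memT, Fin.snoc] using this

theorem realize_compositionAx_of_models_SF (h : M ⊨ SF) : M ⊨ compositionAx := by
  rw [realize_compositionAx]
  intro R S
  have := comprehension_of_models_SF h (m := 2)
    (∃' ∃' ∃' ∃' ∃' (
      ∀' (memT (&5) elemVar ⇔ (Term.bdEqual (&5) (&0) ⊔ Term.bdEqual (&5) (&2))) ⊓
      (memT (&3) (paramVar 0) ⊓ (memT (&4) (paramVar 1) ⊓
      (∀' (memT (&5) (&3) ⇔ (Term.bdEqual (&5) (&0) ⊔ Term.bdEqual (&5) (&1))) ⊓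
      ∀' (memT (&5) (&4) ⇔ (Term.bdEqual (&5) (&1) ⊔ Term.bdEqual (&5) (&2))))))))
    ⟨Sum.elim (fun _ => 2) (fun _ => 1), by
      simp only [stratifiedBy_ex]
      -- Types of `a, b, c, r, s`; the element `y` has type 1 and `R`, `S` have type 2.
      exact ⟨0, 0, 0, 1, 1, by simp [Fin.snoc]⟩⟩ ![R, S]
  simpa [realize_formula, realize_memT, Fin.snoc, BoundedFormula.realize_iff] using this

end Comprehension

theorem models_sixAxioms_iff_models_SF {M : Type*} [L.Structure M] [Nonempty M] :
    M ⊨ sixAxioms ↔ M ⊨ SF :=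
  ⟨fun h => models_SF_of_sixClosed (models_sixAxioms_iff.1 h),
    fun h => models_sixAxioms_iff.2 (sixClosed_of_models_SF h)⟩

theorem models_of_forall_model {T T' : L.Theory} {σ : L.Sentence}
    (hTT' : ∀ (M : Type) [L.Structure M] [Nonempty M], M ⊨ T' → M ⊨ T) (h : T ⊨ᵇ σ) :
    T' ⊨ᵇ σ := by
  rw [models_sentence_iff] at h ⊢
  intro M
  have := hTT' M M.is_model
  exact h (ModelType.of T M)

end StratSet

theorem mainTheorem2 :
    (StratSet.sixAxioms ⊨ᵇ StratSet.compositionAx) ∧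
    StratSet.sixAxioms.Finite ∧
    ∀ σ : StratSet.L.Sentence, (StratSet.sixAxioms ⊨ᵇ σ) ↔ (StratSet.SF ⊨ᵇ σ) := by
  refine ⟨?_, ?_, fun σ => ⟨?_, ?_⟩⟩
  · rw [models_sentence_iff]
    intro M
    exact StratSet.realize_compositionAx_of_models_SF
      (StratSet.models_sixAxioms_iff_models_SF.1 M.is_model)
  · simp [StratSet.sixAxioms]
  · exact StratSet.models_of_forall_model fun M _ _ =>
      StratSet.models_sixAxioms_iff_models_SF.2
  · exact StratSet.models_of_forall_model fun M _ _ =>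
      StratSet.models_sixAxioms_iff_models_SF.1
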